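/- Let $H_n$ denote the physicists' Hermite polynomials, $H_n(t)=(-1)^n e^{t^2}\frac{d^n}{dt^n}e^{-t^2}$. For $\sigma>0$, $\rho>0$ and $N\in\mathbb N$, let $t_1>t_2>\dots>t_N$ be the zeros of $H_N$, put $$\lambda_j:=-\mathrm i\,\sqrt{\frac{2(\rho+\sigma)}{\sigma(2\rho+\sigma)}}\;t_j,\qquad j=1,\dots,N,$$ and let $\gamma_1,\dots,\gamma_N\in\mathbb C$ be the solution of the linear system $$\sum_{j=1}^{N} e^{(\lambda_j-\lambda_k)^2\rho/2}\,\gamma_j=\sqrt{\frac{\sigma}{\sigma+\rho}}\;e^{\frac{\sigma\rho\lambda_k^2}{2(\sigma+\rho)}},\qquad k=1,\dots,N.$$ **Theorem.** Let $\sigma>0$. There is a constant $\tilde c>0$ (depending only on $\sigma$, not on $N$) such that for every integer $N>1$ the following holds. Let $\lambda_j,\gamma_j$ be as above for the choice $\rho=\sigma/2$, and let $T:=\sqrt{2\sigma N\ln 2}$. Then $$\Big\|\,e^{-\cdot^2/(2\sigma)}-\chi_{[-T,T]}(\cdot)\sum_{k=1}^{N}\gamma_k\,e^{\lambda_k\,\cdot}\Big\|_{L^2(\mathbb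 R)}^2\;\le\;\tilde c\;2^{-2N}\,N^{3/2},$$ where $\chi_{[-T,T]}$ is the characteristic function of $[-T,T]$ and the norm is the unweighted $L^2(\mathbb R)$ norm. -/

import Mathlib

open Polynomial MeasureTheory

/-- The physicists' Hermite polynomials: `H₀ = 1`, `Hₙ₊₁(x) = 2 x Hₙ(x) - Hₙ'(x)`. -/
noncomputable def physHermite : ℕ → ℝ[X]
  | 0 => 1
  | n + 1 => C 2 * X * physHermite n - derivative (physHermite n)

/-- Rodrigues' formula `Hₙ(x) = (-1)ⁿ e^{x²} (dⁿ/dxⁿ) e^{-x²}`: the recursion above gives the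
usual Hermite polynomials. -/
theorem physHermite_rodrigues (n : ℕ) (x : ℝ) :
    (physHermite n).eval x =
      (-1) ^ n * Real.exp (x ^ 2) * iteratedDeriv n (fun y : ℝ => Real.exp (-y ^ 2)) x := by
  have key : ∀ n : ℕ, iteratedDeriv n (fun y : ℝ => Real.exp (-y ^ 2)) =
      fun y => (-1) ^ n * ((physHermite n).eval y * Real.exp (-y ^ 2)) := by
    intro n
    induction n with
    | zero => ext y; simp [physHermite]
    | succ k ih =>
      ext y
      rw [iteratedDeriv_succ, ih]
      have h1 : HasDerivAt (fun y : ℝ => Real.exp (-y ^ 2))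
          (Real.exp (-y ^ 2) * (-(2 * y))) y := by
        have := ((hasDerivAt_pow 2 y).neg).exp
        simpa using this
      have h2 := (((physHermite k).hasDerivAt y).mul h1).const_mul ((-1 : ℝ) ^ k)
      refine h2.deriv.trans ?_
      simp only [physHermite, eval_sub, eval_mul, eval_C, eval_X]
      ring
  rw [key]
  have h3 : Real.exp (x ^ 2) * Real.exp (-x ^ 2) = 1 := by
    rw [← Real.exp_add]; simp
  have h4 : ((-1 : ℝ) ^ n) * (-1) ^ n = 1 := by
    rw [← mul_pow]; norm_num
  calc (physHermite n).eval x
      = ((-1) ^ n * (-1) ^ n) * (Real.exp (x ^ 2) * Real.exp (-x ^ 2))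
          * (physHermite n).eval x := by rw [h3, h4]; ring
    _ = _ := by ring

/-- `t 0 > t 1 > ... > t (N - 1)` is the decreasing list of all the zeros of the Hermite polynomial
`H_N` (which are real, simple, and `N` in number). -/
def IsHermiteZeros (N : ℕ) (t : Fin N → ℝ) : Prop :=
  StrictAnti t ∧ Set.range t = {x : ℝ | (physHermite N).eval x = 0}

/-- The frequencies `lam` and coefficients `gam` are the output of the differential Prony-type
method with parameters `σ, ρ` and order `N` for the Gaussian `e^{-x²/(2σ)}`:
the frequencies are `λ_j = -i √(2(ρ+σ)/(σ(2ρ+σ))) t_j`, where `t_j` are the ordered zeros of `H_N`,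
and the coefficients solve the linear system
`∑_j e^{(λ_j - λ_k)² ρ/2} γ_j = √(σ/(σ+ρ)) e^{σ ρ λ_k² / (2(σ+ρ))}`, `k = 1, ..., N`. -/
def IsPronyOutput (σ ρ : ℝ) (N : ℕ) (lam gam : Fin N → ℂ) : Prop :=
  (∃ t : Fin N → ℝ, IsHermiteZeros N t ∧
    ∀ j, lam j =
      -Complex.I * (Real.sqrt (2 * (ρ + σ) / (σ * (2 * ρ + σ))) : ℂ) * (t j : ℂ)) ∧
  ∀ k, ∑ j, Complex.exp ((lam j - lam k) ^ 2 * (ρ : ℂ) / 2) * gam j =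
    (Real.sqrt (σ / (σ + ρ)) : ℂ) *
      Complex.exp ((σ : ℂ) * (ρ : ℂ) * lam k ^ 2 / (2 * ((σ : ℂ) + (ρ : ℂ))))

/-- The exponential sum `x ↦ ∑_k γ_k e^{λ_k x}`. -/
noncomputable def expSum {N : ℕ} (lam gam : Fin N → ℂ) (x : ℝ) : ℂ :=
  ∑ k, gam k * Complex.exp (lam k * (x : ℂ))

/-!
The proof compares two weighted `L²` problems. With `ρ = σ/2` the linear system for `γ` is the system
of normal equations of best approximation of `e^{-x²/(2σ)}` by `∑ γ_k e^{λ_k x}` in `L²` with weight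
`e^{-x²/σ}` (`integral_error_mul_cexp_eq_zero`), because the frequencies are imaginary. So the weighted
error of the given exponential sum is at most that of any other one with the same frequencies
(`lintegral_weighted_error_le`). On `[-T, T]` the weight is at least `e^{-T²/σ} = 4^{-N}`, and off
`[-T, T]` the Gaussian itself has squared norm `O(4^{-N})` (`eLpNorm_error_sq_le`). It therefore
suffices to exhibit coefficients with squared weighted error `O(N 16^{-N})`.

These come from Gauss–Hermite quadrature. Let `d(z)` be the error of the interpolatory rule with the
nodes `t_j` on `t ↦ e^{2tz}`, for the probability measure `π^{-1/2} e^{-t²} dt`. The decisive estimate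
(`norm_quadErr_one_le_of_re_ne_zero`) is
`|d(z)| ≤ 2^N N!/(2N)! |z|^{2N} e^{(Re z)²}`,
whose gain over the obvious bound is that only `Re z` occurs in the exponential. Applying the
quadrature error to `p(t) e^{2tz}` instead, for a polynomial `p`, turns differentiation in `z` into
multiplication of `p` by `2t`, and gives an initial value `0` at `z = 0` when `deg p < N`. Two chains
of first-order equations result, both ending in the explicit value `(2z)^N e^{z²}` at `p = H_N`:
* for the partial products of `H_N = ∏ (2t - 2t_j)`, the coefficients are real constants, and
  integration along rays reduces the estimate to real `z` (`norm_le_of_ode_chain`);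
* for `p = H_n`, the three-term recurrence gives a cooperative system, with an explicit supersolution
  for real `z` (`hermite_chain_le`).

Integrating `d(η - iy)` against a complex Gaussian in `η` produces the difference of `e^{-3y²}` and an
exponential sum in `y` with frequencies proportional to `i t_j` (`integral_quadErr_one_mul_cexp`), that
is, the wanted approximation after scaling. The Cauchy–Schwarz inequality and
`∫_ℂ |z|^{4N} e^{-4|z|²} = π (2N)!/4^{2N+1}` then give its weighted error.
-/

/-! ### Hermite polynomials and the quadrature error -/

theorem derivative_physHermite_succ (n : ℕ) :
    derivative (physHermite (n + 1)) = C (2 * ((n : ℝ) + 1)) * physHermite n := by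
  induction n with
  | zero => simp [physHermite]
  | succ k ih =>
    have h : physHermite (k + 1 + 1) =
        C 2 * X * physHermite (k + 1) - derivative (physHermite (k + 1)) := rfl
    have h' : physHermite (k + 1) = C 2 * X * physHermite k - derivative (physHermite k) := rfl
    have hd : derivative (derivative (physHermite (k + 1))) =
        C (2 * ((k : ℝ) + 1)) * derivative (physHermite k) := by
      rw [ih, derivative_C_mul]
    rw [h, derivative_sub, hd, derivative_mul, ih]
    simp only [derivative_mul, derivative_C, derivative_X]
    rw [h']
    push_cast
    simp only [C_mul, C_add, C_1]
    ring

theorem two_mul_X_mul_physHermite (n : ℕ) :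
    C 2 * X * physHermite n = physHermite (n + 1) + C (2 * (n : ℝ)) * physHermite (n - 1) := by
  have h : physHermite (n + 1) = C 2 * X * physHermite n - derivative (physHermite n) := rfl
  cases n with
  | zero => simp [physHermite]
  | succ k => rw [h, derivative_physHermite_succ]; push_cast; simp

theorem physHermite_natDegree_le (n : ℕ) : (physHermite n).natDegree ≤ n := by
  induction n with
  | zero => simp [physHermite]
  | succ k ih =>
    have h : physHermite (k + 1) = C 2 * X * physHermite k - derivative (physHermite k) := rfl
    rw [h]
    refine (natDegree_sub_le _ _).trans (max_le ?_ ?_)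
    · refine natDegree_mul_le.trans ?_
      have : (C (2 : ℝ) * X).natDegree ≤ 1 := by simp
      omega
    · exact (natDegree_derivative_le _).trans (by omega)

theorem physHermite_coeff_self (n : ℕ) : (physHermite n).coeff n = 2 ^ n := by
  induction n with
  | zero => simp [physHermite]
  | succ k ih =>
    have h : physHermite (k + 1) = C 2 * X * physHermite k - derivative (physHermite k) := rfl
    have h0 : (derivative (physHermite k)).coeff (k + 1) = 0 := by
      apply coeff_eq_zero_of_natDegree_lt
      have := natDegree_derivative_le (physHermite k)
      have := physHermite_natDegree_le k
      omega
    rw [h, coeff_sub, h0, mul_assoc, coeff_C_mul, coeff_X_mul, ih]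
    ring

theorem IsHermiteZeros.physHermite_eq {N : ℕ} {t : Fin N → ℝ} (ht : IsHermiteZeros N t) :
    physHermite N = ∏ i, (C 2 * X - C (2 * t i)) := by
  have hinj : Function.Injective t := ht.1.injective
  have hprod : ∏ i, (C 2 * X - C (2 * t i)) = C (2 ^ N) * Lagrange.nodal Finset.univ t := by
    have h : ∀ i, (C 2 * X - C (2 * t i) : ℝ[X]) = C 2 * (X - C (t i)) := fun i => by
      rw [C_mul]; ring
    simp_rw [h, Finset.prod_mul_distrib, Lagrange.nodal]
    simp
  rw [hprod]
  refine eq_of_degree_sub_lt_of_eval_index_eq (s := Finset.univ) (v := t)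
    hinj.injOn ?_ ?_
  · rw [Finset.card_univ, Fintype.card_fin]
    refine degree_lt_iff_coeff_zero _ _ |>.2 fun m hm => ?_
    have hdeg : (Lagrange.nodal Finset.univ t).natDegree = N := by
      rw [Lagrange.natDegree_nodal, Finset.card_univ, Fintype.card_fin]
    rcases hm.eq_or_lt with rfl | hlt
    · have h1 := (Lagrange.nodal_monic (s := Finset.univ) (v := t)).coeff_natDegree
      rw [hdeg] at h1
      rw [coeff_sub, coeff_C_mul, h1, physHermite_coeff_self]; ring
    · rw [coeff_sub, coeff_C_mul, coeff_eq_zero_of_natDegree_lt, coeff_eq_zero_of_natDegree_lt]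
      · ring
      · rwa [hdeg]
      · exact (physHermite_natDegree_le N).trans_lt hlt
  · intro i _
    have hi : t i ∈ Set.range t := ⟨i, rfl⟩
    rw [ht.2] at hi
    rw [eval_mul, Lagrange.eval_nodal_at_node (Finset.mem_univ i), mul_zero]
    exact hi

/-- The polynomial `P` with `P(z) e^{z²} = π^{-1/2} ∫ p(t) e^{2tz} e^{-t²} dt`, defined
algebraically: it is `p`, evaluated at the operator `X + D/2`, applied to `1`. -/
noncomputable def gaussTransform (p : ℝ[X]) : ℝ[X] :=
  aeval (LinearMap.mulLeft ℝ (X : ℝ[X]) + (2⁻¹ : ℝ) • (derivative : ℝ[X] →ₗ[ℝ] ℝ[X])) p 1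

theorem gaussTransform_one : gaussTransform 1 = 1 := by simp [gaussTransform]

theorem gaussTransform_add (p q : ℝ[X]) :
    gaussTransform (p + q) = gaussTransform p + gaussTransform q := by
  simp [gaussTransform]

theorem gaussTransform_C_mul (c : ℝ) (p : ℝ[X]) :
    gaussTransform (C c * p) = C c * gaussTransform p := by
  rw [gaussTransform, C_mul', map_smul, LinearMap.smul_apply, ← C_mul']; rfl

theorem gaussTransform_sum {ι : Type*} (s : Finset ι) (p : ι → ℝ[X]) :
    gaussTransform (∑ i ∈ s, p i) = ∑ i ∈ s, gaussTransform (p i) := by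
  simp [gaussTransform]

theorem gaussTransform_two_mul_X_mul (p : ℝ[X]) :
    gaussTransform (C 2 * X * p) =
      derivative (gaussTransform p) + C 2 * X * gaussTransform p := by
  rw [mul_assoc, gaussTransform_C_mul]
  have h : gaussTransform (X * p) =
      X * gaussTransform p + (2⁻¹ : ℝ) • derivative (gaussTransform p) := by
    simp [gaussTransform]
  rw [h, smul_eq_C_mul, mul_add, ← mul_assoc (C 2) (C _), ← C_mul]
  norm_num
  ring

theorem gaussTransform_physHermite (n : ℕ) :
    gaussTransform (physHermite n) = (C 2 * X) ^ n := by
  induction n using Nat.strong_induction_on with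
  | _ n ih =>
    cases n with
    | zero => simp [physHermite, gaussTransform_one]
    | succ k =>
      have h : physHermite (k + 1) =
          C 2 * X * physHermite k + C (-(2 * (k : ℝ))) * physHermite (k - 1) := by
        rw [two_mul_X_mul_physHermite, C_neg]; ring
      rw [h, gaussTransform_add, gaussTransform_two_mul_X_mul, gaussTransform_C_mul,
        ih k (by omega), ih (k - 1) (by omega), derivative_pow, C_neg, C_mul]
      simp only [derivative_mul, derivative_C, derivative_X]
      ring

/-- The error, on the function `t ↦ p(t) e^{2tz}`, of the quadrature rule with nodes `t j` and
weights `w j` for the probability measure `π^{-1/2} e^{-t²} dt`. -/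
noncomputable def quadErr {N : ℕ} (t w : Fin N → ℝ) (p : ℝ[X]) (z : ℂ) : ℂ :=
  Complex.exp (z ^ 2) * aeval z (gaussTransform p)
    - ∑ j, (w j : ℂ) * ((p.eval (t j) : ℝ) : ℂ) * Complex.exp (2 * t j * z)

section quadErr
variable {N : ℕ} (t w : Fin N → ℝ)

theorem quadErr_add (p q : ℝ[X]) (z : ℂ) :
    quadErr t w (p + q) z = quadErr t w p z + quadErr t w q z := by
  simp only [quadErr, gaussTransform_add, map_add, eval_add, Complex.ofReal_add, mul_add, add_mul,
    Finset.sum_add_distrib]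
  ring

theorem quadErr_C_mul (c : ℝ) (p : ℝ[X]) (z : ℂ) :
    quadErr t w (C c * p) z = c * quadErr t w p z := by
  simp only [quadErr, gaussTransform_C_mul, map_mul, aeval_C, eval_mul, eval_C,
    Complex.ofReal_mul, mul_sub, Finset.mul_sum, Complex.coe_algebraMap]
  congr 1
  · ring
  · exact Finset.sum_congr rfl fun j _ => by ring

theorem hasDerivAt_quadErr (p : ℝ[X]) (z : ℂ) :
    HasDerivAt (quadErr t w p) (quadErr t w (C 2 * X * p) z) z := by
  have h1 : HasDerivAt (fun z : ℂ => Complex.exp (z ^ 2)) (Complex.exp (z ^ 2) * (2 * z)) z := by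
    simpa using (hasDerivAt_pow 2 z).cexp
  have h2 := h1.mul ((gaussTransform p).hasDerivAt_aeval z)
  have h3 : HasDerivAt (fun z : ℂ => ∑ j, (w j : ℂ) * ((p.eval (t j) : ℝ) : ℂ) *
      Complex.exp (2 * t j * z)) (∑ j, (w j : ℂ) * ((p.eval (t j) : ℝ) : ℂ) *
      (Complex.exp (2 * t j * z) * (2 * t j))) z := by
    refine HasDerivAt.fun_sum fun j _ => HasDerivAt.const_mul _ ?_
    simpa using ((hasDerivAt_id z).const_mul (2 * (t j : ℂ))).cexp
  refine (h2.sub h3).congr_deriv ?_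
  simp only [quadErr, gaussTransform_two_mul_X_mul, map_add, map_mul, aeval_C, aeval_X, eval_mul,
    eval_C, eval_X, Complex.coe_algebraMap]
  push_cast
  congr 1
  · ring
  · exact Finset.sum_congr rfl fun j _ => by ring

theorem quadErr_physHermite_self (ht : IsHermiteZeros N t) (z : ℂ) :
    quadErr t w (physHermite N) z = (2 * z) ^ N * Complex.exp (z ^ 2) := by
  have h : ∀ j, (physHermite N).eval (t j) = 0 := fun j => by
    have hj : t j ∈ Set.range t := ⟨j, rfl⟩
    rwa [ht.2] at hj
  simp only [quadErr, h, gaussTransform_physHermite, map_pow, map_mul, aeval_C, aeval_X]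
  simp [mul_comm]

end quadErr

/-- Interpolatory quadrature: for distinct nodes there are weights exact in degree `< N`. -/
theorem exists_weights_quadErr_zero {N : ℕ} {t : Fin N → ℝ} (ht : Function.Injective t) :
    ∃ w : Fin N → ℝ, ∀ p : ℝ[X], p.degree < N → quadErr t w p 0 = 0 := by
  refine ⟨fun j => (gaussTransform (Lagrange.basis Finset.univ t j)).eval 0, fun p hp => ?_⟩
  have h : p = ∑ j, C (p.eval (t j)) * Lagrange.basis Finset.univ t j := by
    have := Lagrange.eq_interpolate (s := Finset.univ) (v := t) (f := p) ht.injOn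
      (by simpa using hp)
    simpa [Lagrange.interpolate_apply] using this
  have h2 : (gaussTransform p).eval 0 = ∑ j, p.eval (t j) *
      (gaussTransform (Lagrange.basis Finset.univ t j)).eval 0 := by
    conv_lhs => rw [h, gaussTransform_sum]
    simp only [gaussTransform_C_mul, eval_finsetSum, eval_mul, eval_C]
  have h3 : aeval (0 : ℂ) (gaussTransform p) = (((gaussTransform p).eval 0 : ℝ) : ℂ) := by
    have := aeval_algebraMap_apply ℂ (0 : ℝ) (gaussTransform p)
    simpa using this
  rw [quadErr, h3, h2]
  push_cast
  simp only [mul_zero, Complex.exp_zero, mul_one, ne_eq, OfNat.ofNat_ne_zero, not_false_eq_true,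
    zero_pow, one_mul]
  rw [sub_eq_zero]
  exact Finset.sum_congr rfl fun j _ => mul_comm _ _

/-! ### Comparison for chains of first-order equations -/

/-- Comparison along rays for a chain of first-order equations `F (k+1)' = F k + τ k * F (k+1)` with
real `τ k` and zero initial values. Each step multiplies by the kernel `e^{τ k (z - ζ)}`, whose
modulus only depends on real parts, so the modulus at `z` is controlled by the value at `Re z`, up
to the ratio `‖z‖ / Re z` of the lengths of the paths of integration. -/
theorem norm_le_of_ode_chain {K m : ℕ} {F : ℕ → ℂ → ℂ} {τ : ℕ → ℝ}
    (hF : ∀ k < K, ∀ z, HasDerivAt (F (k + 1)) (F k z + τ k * F (k + 1) z) z)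
    (h0 : ∀ k ≤ K, F k 0 = 0)
    (hbase : ∀ z : ℂ, 0 < z.re → ‖F 0 z‖ ≤ (‖z‖ / z.re) ^ m * (F 0 z.re).re) :
    ∀ k ≤ K, ∀ z : ℂ, 0 < z.re → ‖F k z‖ ≤ (‖z‖ / z.re) ^ (m + k) * (F k z.re).re := by
  intro k
  induction k with
  | zero => intro _ z hz; simpa using hbase z hz
  | succ k ih =>
    intro hk z hz
    set a := z.re with ha
    set c := ‖z‖ / a with hc
    have hca : ‖z‖ = c * a := by rw [hc]; field_simp
    -- The chain along the segment `θ ↦ θ z`, after removal of the factor `e^{τ k θ z}`.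
    have hf : ∀ θ : ℝ, HasDerivAt (fun θ : ℝ => Complex.exp (-(τ k * z * θ)) * F (k + 1) (z * θ))
        (z * Complex.exp (-(τ k * z * θ)) * F k (z * θ)) θ := by
      intro θ
      have h1 : HasDerivAt (fun w : ℂ => Complex.exp (-(τ k * z * w)) * F (k + 1) (z * w))
          (z * Complex.exp (-(τ k * z * θ)) * F k (z * θ)) (θ : ℂ) := by
        have h2 : HasDerivAt (fun w : ℂ => Complex.exp (-(τ k * z * w)))
            (Complex.exp (-(τ k * z * θ)) * -(τ k * z)) (θ : ℂ) := by
          simpa using ((hasDerivAt_id (θ : ℂ)).const_mul (τ k * z)).neg.cexp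
        have h3 : HasDerivAt (fun w : ℂ => F (k + 1) (z * w))
            ((F k (z * θ) + τ k * F (k + 1) (z * θ)) * z) (θ : ℂ) := by
          have h4 : HasDerivAt (fun w : ℂ => z * w) z (θ : ℂ) := by
            simpa using (hasDerivAt_id (θ : ℂ)).const_mul z
          exact (hF k hk (z * θ)).comp (θ : ℂ) h4
        refine (h2.mul h3).congr_deriv ?_
        ring
      exact h1.comp_ofReal
    have hB : ∀ θ : ℝ, HasDerivAt
        (fun θ : ℝ => c ^ (m + (k + 1)) * (Real.exp (-(τ k * a * θ)) * (F (k + 1) (a * θ : ℝ)).re))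
        (c ^ (m + (k + 1)) * (a * Real.exp (-(τ k * a * θ)) * (F k (a * θ : ℝ)).re)) θ := by
      intro θ
      refine HasDerivAt.const_mul _ ?_
      have h2 : HasDerivAt (fun w : ℝ => Real.exp (-(τ k * a * w)))
          (Real.exp (-(τ k * a * θ)) * -(τ k * a)) θ := by
        simpa using ((hasDerivAt_id θ).const_mul (τ k * a)).neg.exp
      have h3 : HasDerivAt (fun w : ℝ => (F (k + 1) (a * w : ℝ)).re)
          (((F k (a * θ : ℝ)).re + τ k * (F (k + 1) (a * θ : ℝ)).re) * a) θ := by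
        have h4 : HasDerivAt (fun w : ℝ => a * w) a θ := by
          simpa using (hasDerivAt_id θ).const_mul a
        have h5 := (hF k hk ((a * θ : ℝ) : ℂ)).real_of_complex
        have h6 := HasDerivAt.comp (h₂ := fun x : ℝ => (F (k + 1) x).re) θ h5 h4
        refine h6.congr_deriv ?_
        simp
      refine (h2.mul h3).congr_deriv ?_
      ring
    have key := image_norm_le_of_norm_deriv_right_le_deriv_boundary (a := 0) (b := 1)
      (fun θ _ => (hf θ).continuousAt.continuousWithinAt)
      (fun θ _ => (hf θ).hasDerivWithinAt) (by simp [h0 (k + 1) hk]) hB ?_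
      (Set.right_mem_Icc.2 zero_le_one)
    · have hn : ‖Complex.exp (-(τ k * z * (1 : ℝ)))‖ = Real.exp (-(τ k * a)) := by
        rw [Complex.norm_exp]; simp [ha]
      rw [norm_mul, hn] at key
      simp only [mul_one, Complex.ofReal_one] at key
      rw [mul_left_comm] at key
      exact le_of_mul_le_mul_left key (Real.exp_pos _)
    · rintro θ ⟨hθ, -⟩
      have hn : ‖Complex.exp (-(τ k * z * θ))‖ = Real.exp (-(τ k * a * θ)) := by
        rw [Complex.norm_exp]; simp [ha]
      rw [norm_mul, norm_mul, hn, hca]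
      rcases hθ.eq_or_lt with rfl | hθ
      · simp [h0 k (by omega)]
      have hre : (z * θ).re = a * θ := by simp [ha]
      have h1 := ih (by omega) (z * θ) (by rw [hre]; positivity)
      have hq : ‖z * θ‖ / (a * θ) = c := by
        rw [norm_mul, hca, Complex.norm_real, Real.norm_of_nonneg hθ.le]
        field_simp
      rw [hre, hq] at h1
      calc c * a * Real.exp (-(τ k * a * θ)) * ‖F k (z * θ)‖
          ≤ c * a * Real.exp (-(τ k * a * θ)) * (c ^ (m + k) * (F k (a * θ : ℝ)).re) := by
            gcongr
        _ = _ := by ring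

/-- Solutions of the differential inequalities `e n' ≥ e (n+1) + 2 n e (n-1)`, `n < N`, with
nonnegative initial values and nonnegative `e N` stay nonnegative. A lower bound `-M` on `[0, X]`
improves, by integrating `j` times, to `-M (K x)^j / j!`. -/
theorem nonneg_of_deriv_ge {N : ℕ} {e e' : ℕ → ℝ → ℝ}
    (he : ∀ n < N, ∀ x, HasDerivAt (e n) (e' n x) x)
    (hge : ∀ n < N, ∀ x, 0 ≤ x → e (n + 1) x + 2 * n * e (n - 1) x ≤ e' n x)
    (h0 : ∀ n < N, 0 ≤ e n 0) (hN : ∀ x, 0 ≤ x → 0 ≤ e N x) :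
    ∀ n ≤ N, ∀ x, 0 ≤ x → 0 ≤ e n x := by
  intro n hn X hX
  obtain ⟨M, hM0, hM⟩ : ∃ M : ℝ, 0 ≤ M ∧ ∀ n ≤ N, ∀ x ∈ Set.Icc 0 X, -M ≤ e n x := by
    have h : ∀ n, ∃ M : ℝ, 0 ≤ M ∧ (n ≤ N → ∀ x ∈ Set.Icc 0 X, -M ≤ e n x) := by
      intro n
      rcases lt_trichotomy n N with h | rfl | h
      · obtain ⟨x₀, -, hx₀⟩ := isCompact_Icc.exists_isMinOn (Set.nonempty_Icc.2 hX)
          (fun x _ => (he n h x).continuousAt.continuousWithinAt)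
        refine ⟨|e n x₀|, abs_nonneg _, fun _ x hx => ?_⟩
        have := hx₀ hx
        exact (neg_abs_le _).trans this
      · exact ⟨0, le_rfl, fun _ x hx => by simpa using hN x hx.1⟩
      · exact ⟨0, le_rfl, fun h' => absurd h' (by omega)⟩
    choose M hM0 hM using h
    refine ⟨∑ n ∈ Finset.range (N + 1), M n, Finset.sum_nonneg fun n _ => hM0 n,
      fun n hn x hx => le_trans (neg_le_neg ?_) (hM n hn x hx)⟩
    exact Finset.single_le_sum (f := M) (fun n _ => hM0 n) (Finset.mem_range.2 (by omega))
  set K : ℝ := 2 * N + 1 with hK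
  have hK0 : 0 ≤ K := by positivity
  have key : ∀ j : ℕ, ∀ n ≤ N, ∀ x ∈ Set.Icc 0 X, -(M * ((K * x) ^ j / j.factorial)) ≤ e n x := by
    intro j
    induction j with
    | zero => simpa using hM
    | succ j ih =>
      intro n hn x hx
      rcases hn.eq_or_lt with rfl | hn
      · refine le_trans ?_ (hN x hx.1)
        have := hx.1
        rw [neg_nonpos]
        positivity
      have hd : ∀ y, HasDerivAt
          (fun y => e n y + M * ((K * y) ^ (j + 1) / (j + 1).factorial))
          (e' n y + M * (K * (K * y) ^ j / j.factorial)) y := by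
        intro y
        refine (he n hn y).add (HasDerivAt.const_mul _ ?_)
        have h1 : HasDerivAt (fun y : ℝ => K * y) K y := by
          simpa using (hasDerivAt_id y).const_mul K
        refine ((h1.pow (j + 1)).div_const _).congr_deriv ?_
        rw [Nat.factorial_succ]
        have : (j.factorial : ℝ) ≠ 0 := by positivity
        push_cast
        field_simp
      have hmono : MonotoneOn (fun y => e n y + M * ((K * y) ^ (j + 1) / (j + 1).factorial))
          (Set.Icc 0 X) := by
        refine monotoneOn_of_hasDerivWithinAt_nonneg (convex_Icc 0 X)
          (fun y _ => (hd y).continuousAt.continuousWithinAt)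
          (fun y _ => (hd y).hasDerivWithinAt) fun y hy => ?_
        rw [interior_Icc] at hy
        have hy' : y ∈ Set.Icc 0 X := ⟨hy.1.le, hy.2.le⟩
        set P := M * ((K * y) ^ j / j.factorial) with hP
        have hP0 : 0 ≤ P := by have := hy'.1; positivity
        have h1 := hge n hn y hy'.1
        have h2 := ih (n + 1) hn y hy'
        have h3 := ih (n - 1) (by omega) y hy'
        have hnN : (n : ℝ) ≤ N := by exact_mod_cast hn.le
        have h4 : 2 * (n : ℝ) * (-P) ≤ 2 * n * e (n - 1) y := by gcongr
        have h5 : M * (K * (K * y) ^ j / j.factorial) = K * P := by rw [hP]; ring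
        rw [h5, hK]
        nlinarith
      have h6 := hmono (Set.left_mem_Icc.2 hX) hx hx.1
      have h7 := h0 n hn
      simp only [mul_zero, ne_eq, Nat.add_eq_zero_iff, one_ne_zero, and_false, not_false_eq_true,
        zero_pow, zero_div, add_zero] at h6
      linarith
  have hlim : Filter.Tendsto (fun j : ℕ => -(M * ((K * X) ^ j / j.factorial))) Filter.atTop
      (nhds 0) := by
    simpa using ((FloorSemiring.tendsto_pow_div_factorial_atTop (K * X)).const_mul M).neg
  exact le_of_tendsto' hlim fun j => key j n hn X ⟨hX, le_rfl⟩

/-- The solution of `y n' = y (n+1) + 2 n y (n-1)`, `n < N`, with zero initial values and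
`y N = (2x)^N e^{x²}` lies below the explicit supersolution
`b n = 2^N N! / (2N - n)! * x^(2N - n) * e^{x²}`. -/
theorem hermite_chain_le {N : ℕ} {y : ℕ → ℝ → ℝ}
    (hy : ∀ n < N, ∀ x, HasDerivAt (y n) (y (n + 1) x + 2 * n * y (n - 1) x) x)
    (h0 : ∀ n < N, y n 0 = 0) (hN : ∀ x, y N x = (2 * x) ^ N * Real.exp (x ^ 2))
    {x : ℝ} (hx : 0 ≤ x) :
    y 0 x ≤ 2 ^ N * N.factorial / (2 * N).factorial * x ^ (2 * N) * Real.exp (x ^ 2) := by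
  set b : ℕ → ℝ → ℝ := fun n x =>
    2 ^ N * N.factorial / (2 * N - n).factorial * x ^ (2 * N - n) * Real.exp (x ^ 2) with hb
  have hbd : ∀ n < N, ∀ x, HasDerivAt (b n) (b (n + 1) x + 2 * x * b n x) x := by
    intro n hn x
    obtain ⟨l, hl⟩ : ∃ l, 2 * N - n = l + 1 := ⟨2 * N - n - 1, by omega⟩
    have hl' : 2 * N - (n + 1) = l := by omega
    have h1 : HasDerivAt (fun x : ℝ => Real.exp (x ^ 2)) (Real.exp (x ^ 2) * (2 * x)) x := by
      simpa using (hasDerivAt_pow 2 x).exp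
    have h2 := ((hasDerivAt_pow (l + 1) x).const_mul
      (2 ^ N * N.factorial / (l + 1).factorial : ℝ)).mul h1
    simp only [hb, hl, hl']
    refine h2.congr_deriv ?_
    rw [Nat.factorial_succ]
    have : (l.factorial : ℝ) ≠ 0 := by positivity
    push_cast
    field_simp
  have key := nonneg_of_deriv_ge (N := N) (e := fun n x => b n x - y n x)
    (fun n hn x => (hbd n hn x).sub (hy n hn x)) ?_ ?_ ?_ 0 (Nat.zero_le _) x hx
  · simpa [hb] using key
  · intro n hn x hx
    have h1 : 2 * n * b (n - 1) x ≤ 2 * x * b n x := by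
      cases n with
      | zero => simp only [hb]; simp; positivity
      | succ n =>
        obtain ⟨l, hl⟩ : ∃ l, 2 * N - (n + 1) = l := ⟨_, rfl⟩
        have hl' : 2 * N - (n + 1 - 1) = l + 1 := by omega
        have hnl : ((n + 1 : ℕ) : ℝ) ≤ l + 1 := by exact_mod_cast (by omega : n + 1 ≤ l + 1)
        simp only [hb, hl, hl', Nat.factorial_succ]
        have : (l.factorial : ℝ) ≠ 0 := by positivity
        push_cast at hnl ⊢
        calc 2 * ((n : ℝ) + 1) * (2 ^ N * N.factorial / ((l + 1) * l.factorial) * x ^ (l + 1)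
              * Real.exp (x ^ 2))
            ≤ 2 * ((l : ℝ) + 1) * (2 ^ N * N.factorial / ((l + 1) * l.factorial) * x ^ (l + 1)
              * Real.exp (x ^ 2)) := by gcongr
          _ = _ := by field_simp; ring
    linarith
  · intro n hn
    simp only [h0 n hn, hb, sub_zero]
    positivity
  · intro x hx
    have h2 : 2 * N - N = N := by omega
    have : (N.factorial : ℝ) ≠ 0 := by positivity
    simp only [hb, hN, h2, mul_pow]
    field_simp
    simp

/-! ### The quadrature error on exponentials -/

section
variable {N : ℕ} {t w : Fin N → ℝ}

theorem norm_two_mul_pow_mul_cexp_le (N : ℕ) {z : ℂ} (hz : 0 < z.re) :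
    ‖(2 * z) ^ N * Complex.exp (z ^ 2)‖ ≤ (‖z‖ / z.re) ^ N *
      ((2 * (z.re : ℂ)) ^ N * Complex.exp ((z.re : ℂ) ^ 2)).re := by
  have h1 : ((2 * (z.re : ℂ)) ^ N * Complex.exp ((z.re : ℂ) ^ 2)).re =
      (2 * z.re) ^ N * Real.exp (z.re ^ 2) := by
    have : ((2 * (z.re : ℂ)) ^ N * Complex.exp ((z.re : ℂ) ^ 2)) =
      (((2 * z.re) ^ N * Real.exp (z.re ^ 2) : ℝ) : ℂ) := by push_cast; rfl
    rw [this, Complex.ofReal_re]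
  rw [h1, norm_mul, norm_pow, norm_mul, Complex.norm_exp, mul_pow, mul_pow, div_pow, RCLike.norm_ofNat]
  have h2 : (z ^ 2).re ≤ z.re ^ 2 := by
    rw [pow_two, Complex.mul_re]; nlinarith [sq_nonneg z.im]
  calc 2 ^ N * ‖z‖ ^ N * Real.exp (z ^ 2).re ≤ 2 ^ N * ‖z‖ ^ N * Real.exp (z.re ^ 2) := by gcongr
    _ = _ := by field_simp

/-- Two chains of equations starting from the same function `F N = y 0` and ending in
`(2z)^N e^{z²}`: the factored one (`F`) reduces the bound for complex arguments to real arguments,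
the Hermite one (`y`) gives the bound for real arguments. -/
theorem norm_le_of_two_chains (hN : 0 < N) {F y : ℕ → ℂ → ℂ} {τ : ℕ → ℝ}
    (hF : ∀ k < N, ∀ z, HasDerivAt (F (k + 1)) (F k z + τ k * F (k + 1) z) z)
    (hF0 : ∀ k < N, F (k + 1) 0 = 0)
    (hFb : ∀ z, F 0 z = (2 * z) ^ N * Complex.exp (z ^ 2))
    (hy : ∀ n < N, ∀ z, HasDerivAt (y n) (y (n + 1) z + 2 * n * y (n - 1) z) z)
    (hy0 : ∀ n < N, y n 0 = 0) (hyN : ∀ z, y N z = (2 * z) ^ N * Complex.exp (z ^ 2))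
    (hFy : F N = y 0) {z : ℂ} (hz : 0 < z.re) :
    ‖y 0 z‖ ≤ 2 ^ N * N.factorial / (2 * N).factorial * ‖z‖ ^ (2 * N) * Real.exp (z.re ^ 2) := by
  have h1 : ‖y 0 z‖ ≤ (‖z‖ / z.re) ^ (2 * N) * (y 0 z.re).re := by
    have := norm_le_of_ode_chain (m := N) hF ?_ ?_ N le_rfl z hz
    · rwa [hFy, ← two_mul] at this
    · intro k hk
      cases k with
      | zero => simp [hFb, hN.ne']
      | succ k => exact hF0 k hk
    · intro z hz
      rw [hFb, hFb]
      exact norm_two_mul_pow_mul_cexp_le N hz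
  have h2 := hermite_chain_le (N := N) (y := fun n x => (y n x).re) (x := z.re) ?_ ?_ ?_ hz.le
  · calc ‖y 0 z‖ ≤ (‖z‖ / z.re) ^ (2 * N) * (y 0 z.re).re := h1
      _ ≤ (‖z‖ / z.re) ^ (2 * N) * (2 ^ N * N.factorial / (2 * N).factorial * z.re ^ (2 * N)
          * Real.exp (z.re ^ 2)) := by gcongr
      _ = _ := by rw [div_pow]; field_simp
  · intro n hn x
    refine (hy n hn x).real_of_complex.congr_deriv ?_
    have : (2 * (n : ℂ)) = ((2 * n : ℝ) : ℂ) := by push_cast; rfl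
    rw [Complex.add_re, this, Complex.re_ofReal_mul]
  · intro n hn; simp [hy0 n hn]
  · intro x
    have : ((2 * (x : ℂ)) ^ N * Complex.exp ((x : ℂ) ^ 2)) =
      (((2 * x) ^ N * Real.exp (x ^ 2) : ℝ) : ℂ) := by push_cast; rfl
    simp only [hyN, this, Complex.ofReal_re]

theorem hasDerivAt_quadErr_physHermite (n : ℕ) (z : ℂ) :
    HasDerivAt (quadErr t w (physHermite n)) (quadErr t w (physHermite (n + 1)) z
      + 2 * n * quadErr t w (physHermite (n - 1)) z) z := by
  refine (hasDerivAt_quadErr t w _ z).congr_deriv ?_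
  rw [two_mul_X_mul_physHermite, quadErr_add, quadErr_C_mul]
  push_cast
  rfl

theorem hasDerivAt_quadErr_of_factor (a : ℝ) (p : ℝ[X]) (z : ℂ) :
    HasDerivAt (quadErr t w p)
      (quadErr t w ((C 2 * X - C (2 * a)) * p) z + (2 * a : ℝ) * quadErr t w p z) z := by
  refine (hasDerivAt_quadErr t w _ z).congr_deriv ?_
  rw [← quadErr_C_mul, ← quadErr_add]
  congr 1
  ring

/-- The error of Gauss–Hermite quadrature on `t ↦ e^{2tz}`. The point is that the exponential factor
only involves the real part of `z`. -/
theorem norm_quadErr_one_le_of_re_ne_zero (hN : 0 < N) (ht : IsHermiteZeros N t)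
    (hw : ∀ p : ℝ[X], p.degree < N → quadErr t w p 0 = 0) {z : ℂ} (hz : z.re ≠ 0) :
    ‖quadErr t w 1 z‖ ≤
      2 ^ N * N.factorial / (2 * N).factorial * ‖z‖ ^ (2 * N) * Real.exp (z.re ^ 2) := by
  obtain ⟨s, hs⟩ : ∃ s : ℕ → ℝ, ∀ i : Fin N, s i = t i :=
    ⟨fun i => if h : i < N then t ⟨i, h⟩ else 0, fun i => by simp⟩
  -- `P m` is the product of the first `m` factors of `H_N`.
  set P : ℕ → ℝ[X] := fun m => ∏ i ∈ Finset.range m, (C 2 * X - C (2 * s i)) with hP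
  have hPN : P N = physHermite N := by
    rw [ht.physHermite_eq, hP]
    simp only [Finset.prod_range, hs]
  have hPs : ∀ k < N, (C 2 * X - C (2 * s (N - (k + 1)))) * P (N - (k + 1)) = P (N - k) := by
    intro k hk
    have : N - k = N - (k + 1) + 1 := by omega
    rw [this, hP]
    simp only [Finset.prod_range_succ]
    ring
  have hPd : ∀ m < N, (P m).degree < N := by
    intro m hm
    have h1 : ∀ a : ℝ, (C 2 * X - C (2 * a) : ℝ[X]).degree ≤ 1 := fun a => by
      refine (degree_sub_le _ _).trans (max_le ?_ (degree_C_le.trans (by norm_num)))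
      simp
    have h2 : (P m).degree ≤ (m : WithBot ℕ) := by
      refine (degree_prod_le _ _).trans ((Finset.sum_le_card_nsmul _ _ 1 fun i _ => h1 _).trans ?_)
      simp
    exact h2.trans_lt (by exact_mod_cast hm)
  have hHd : ∀ n < N, (physHermite n).degree < N := fun n hn =>
    (degree_le_of_natDegree_le (physHermite_natDegree_le n)).trans_lt (by exact_mod_cast hn)
  have hF : ∀ k < N, ∀ z, HasDerivAt (quadErr t w (P (N - (k + 1))))
      (quadErr t w (P (N - k)) z + (2 * s (N - (k + 1)) : ℝ) * quadErr t w (P (N - (k + 1))) z) z := by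
    intro k hk z
    rw [← hPs k hk]
    exact hasDerivAt_quadErr_of_factor _ _ z
  have hF0 : ∀ k < N, quadErr t w (P (N - (k + 1))) 0 = 0 := fun k hk => hw _ (hPd _ (by omega))
  have hb : ∀ z, quadErr t w (physHermite N) z = (2 * z) ^ N * Complex.exp (z ^ 2) :=
    quadErr_physHermite_self t w ht
  have hy0 : ∀ n < N, quadErr t w (physHermite n) 0 = 0 := fun n hn => hw _ (hHd n hn)
  have hP0 : P 0 = physHermite 0 := by simp [hP, physHermite]
  rcases lt_or_gt_of_ne hz with hz | hz
  · -- The reflected functions satisfy the same equations.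
    have hsq : ∀ m : ℕ, ((-1 : ℂ) ^ m) * (-1) ^ m = 1 := fun m => by
      rw [← mul_pow]; norm_num
    have key := norm_le_of_two_chains (z := -z) hN
      (F := fun k z => (-1) ^ (N + k) * quadErr t w (P (N - k)) (-z))
      (y := fun n z => (-1) ^ n * quadErr t w (physHermite n) (-z))
      (τ := fun k => -(2 * s (N - (k + 1)))) ?_ ?_ ?_ ?_ ?_ ?_ ?_ (by simpa using hz)
    · simpa [physHermite] using key
    · intro k hk z
      have h := ((hF k hk (-z)).scomp z (hasDerivAt_neg z)).const_mul ((-1) ^ (N + (k + 1)))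
      refine h.congr_deriv ?_
      rw [smul_eq_mul]
      push_cast
      ring
    · intro k hk; simp [hF0 k hk]
    · intro z
      simp only [add_zero, Nat.sub_zero, hPN, hb, neg_sq]
      rw [← mul_assoc, ← mul_pow]; ring
    · intro n hn z
      have h := ((hasDerivAt_quadErr_physHermite (t := t) (w := w) n (-z)).scomp z
        (hasDerivAt_neg z)).const_mul ((-1) ^ n)
      refine h.congr_deriv ?_
      rw [smul_eq_mul]
      cases n with
      | zero => simp
      | succ n => simp only [add_tsub_cancel_right]; push_cast; ring
    · intro n hn; simp [hy0 n hn]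
    · intro z
      simp only [hb, neg_sq]
      rw [← mul_assoc, ← mul_pow]; ring
    · ext z
      have : (-1 : ℂ) ^ (N + N) = 1 := by rw [pow_add, hsq]
      simp [this, hP0]
  · have key := norm_le_of_two_chains (z := z) hN (F := fun k => quadErr t w (P (N - k)))
      (y := fun n => quadErr t w (physHermite n)) (τ := fun k => 2 * s (N - (k + 1)))
      hF hF0 (by simpa [hPN] using hb) (fun n _ z => hasDerivAt_quadErr_physHermite n z) hy0 hb
      (by simp [hP0]) hz
    simpa [physHermite] using key

end

/-! ### Gaussian integrals of the quadrature error -/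

/-- The Gaussian integral with a linear exponent, in terms of the real square root. -/
theorem integral_cexp_neg_mul_sq_add {b : ℝ} (hb : 0 < b) (c d : ℂ) :
    ∫ x : ℝ, Complex.exp (-b * x ^ 2 + c * x + d) =
      (Real.sqrt (Real.pi / b) : ℂ) * Complex.exp (d + c ^ 2 / (4 * b)) := by
  rw [integral_cexp_quadratic (by simpa using hb)]
  congr 1
  · have h : ((Real.pi : ℂ) / -(-(b : ℂ))) = ((Real.pi / b : ℝ) : ℂ) := by push_cast; simp
    rw [h, Real.sqrt_eq_rpow, Complex.ofReal_cpow (by positivity)]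
    norm_num
  · congr 1
    rw [mul_neg, div_neg, sub_neg_eq_add]

theorem integrable_cexp_neg_mul_sq_add {b : ℝ} (hb : 0 < b) (c d : ℂ) :
    Integrable fun x : ℝ => Complex.exp (-b * x ^ 2 + c * x + d) :=
  integrable_cexp_quadratic' (by simpa using hb) c d

section
variable {N : ℕ} {t w : Fin N → ℝ}

theorem quadErr_one (z : ℂ) :
    quadErr t w 1 z = Complex.exp (z ^ 2) - ∑ j, (w j : ℂ) * Complex.exp (2 * t j * z) := by
  simp [quadErr, gaussTransform_one]

/-- Integration against a complex Gaussian turns the quadrature error on `e^{2tz}` into the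
difference of a Gaussian and a sum of exponentials with imaginary frequencies. The centre `-iy/2`
of the complex Gaussian is chosen so that, after the square is multiplied by the weight `e^{-6y²}`,
the bound for the quadrature error is integrated against a multiple of `e^{-4|z|²}`. -/
theorem integral_quadErr_one_mul_cexp (y : ℝ) :
    ∫ η : ℝ, quadErr t w 1 (η - Complex.I * y) * Complex.exp (-4 * (η + Complex.I * y / 2) ^ 2) =
      (Real.sqrt (Real.pi / 3) : ℂ) * Complex.exp (-3 * y ^ 2)
        - ∑ j, (w j : ℂ) * ((Real.sqrt (Real.pi / 4) : ℂ) *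
          Complex.exp ((t j : ℂ) ^ 2 / 4 - 3 * Complex.I * t j * y)) := by
  have hsplit : ∀ η : ℝ, quadErr t w 1 (η - Complex.I * y) *
      Complex.exp (-4 * (η + Complex.I * y / 2) ^ 2) =
      Complex.exp (-(3 : ℝ) * η ^ 2 + (-6 * Complex.I * y) * η + 0) -
      ∑ j, (w j : ℂ) * Complex.exp (-(4 : ℝ) * η ^ 2 + (2 * t j - 4 * Complex.I * y) * η +
        (-2 * Complex.I * t j * y + y ^ 2)) := by
    intro η
    rw [quadErr_one, sub_mul, ← Complex.exp_add, Finset.sum_mul]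
    congr 1
    · congr 1
      push_cast
      ring
    · refine Finset.sum_congr rfl fun j _ => ?_
      rw [mul_assoc, ← Complex.exp_add]
      congr 2
      push_cast
      linear_combination -(y : ℂ) ^ 2 * Complex.I_sq
  simp_rw [hsplit]
  rw [integral_sub (integrable_cexp_neg_mul_sq_add (by norm_num) _ _)
    (integrable_finsetSum _ fun j _ =>
      (integrable_cexp_neg_mul_sq_add (by norm_num) _ _).const_mul _),
    integral_finsetSum _ fun j _ =>
      (integrable_cexp_neg_mul_sq_add (by norm_num) _ _).const_mul _]
  simp_rw [integral_const_mul]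
  rw [integral_cexp_neg_mul_sq_add (by norm_num)]
  congr 1
  · congr 2
    push_cast
    linear_combination (3 * (y : ℂ) ^ 2) * Complex.I_sq
  · refine Finset.sum_congr rfl fun j _ => ?_
    rw [integral_cexp_neg_mul_sq_add (by norm_num)]
    congr 3
    push_cast
    linear_combination ((y : ℂ) ^ 2) * Complex.I_sq

end

theorem lintegral_lintegral_normSq_pow_mul_exp (N : ℕ) :
    ∫⁻ y : ℝ, ∫⁻ x : ℝ, ENNReal.ofReal ((x ^ 2 + y ^ 2) ^ (2 * N) *
      Real.exp (-4 * (x ^ 2 + y ^ 2))) =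
      ENNReal.ofReal (Real.pi * (2 * N).factorial / 4 ^ (2 * N + 1)) := by
  have hI : ∫ z : ℂ, (‖z‖ ^ 2) ^ (2 * N) * Real.exp (-4 * ‖z‖ ^ 2) =
      Real.pi * (2 * N).factorial / 4 ^ (2 * N + 1) := by
    have h := Complex.integral_rpow_mul_exp_neg_mul_rpow (p := 2) (q := (4 * N : ℕ)) (b := 4)
      (by norm_num) (by have : (0 : ℝ) ≤ (4 * N : ℕ) := by positivity
                        linarith) (by norm_num)
    have h1 : ((((4 * N : ℕ) : ℝ) + 2) / 2) = ((2 * N : ℕ) : ℝ) + 1 := by push_cast; ring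
    have h2 : (-(((4 * N : ℕ) : ℝ) + 2) / 2) = -((2 * N + 1 : ℕ) : ℝ) := by push_cast; ring
    rw [h1, h2, Real.Gamma_nat_eq_factorial, Real.rpow_neg (by norm_num), Real.rpow_natCast] at h
    simp_rw [Real.rpow_natCast] at h
    have h3 : ∀ z : ℂ, ‖z‖ ^ (4 * N) * Real.exp (-4 * ‖z‖ ^ (2 : ℝ)) =
        (‖z‖ ^ 2) ^ (2 * N) * Real.exp (-4 * ‖z‖ ^ 2) := fun z => by
      rw [← pow_mul, Real.rpow_two]; congr 2; ring
    simp_rw [h3] at h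
    rw [h]
    field_simp
  have hint : Integrable fun z : ℂ => (‖z‖ ^ 2) ^ (2 * N) * Real.exp (-4 * ‖z‖ ^ 2) := by
    refine Integrable.of_integral_ne_zero ?_
    rw [hI]
    positivity
  rw [← hI, ofReal_integral_eq_lintegral_ofReal hint (Filter.Eventually.of_forall fun z => by
    positivity),
    ← Complex.volume_preserving_equiv_real_prod.symm.lintegral_comp (by fun_prop),
    Measure.volume_eq_prod, lintegral_prod_symm' _ (by fun_prop)]
  have h : ∀ x y : ℝ, ‖Complex.measurableEquivRealProd.symm (x, y)‖ ^ 2 = x ^ 2 + y ^ 2 := by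
    intro x y
    rw [Complex.sq_norm, Complex.normSq_apply]
    simp [pow_two]
  simp_rw [h]

theorem sq_lintegral_mul_le {α : Type*} [MeasurableSpace α] {μ : Measure α} {f g : α → ENNReal}
    (hf : AEMeasurable f μ) (hg : AEMeasurable g μ) :
    (∫⁻ a, f a * g a ∂μ) ^ 2 ≤ (∫⁻ a, f a ^ 2 ∂μ) * ∫⁻ a, g a ^ 2 ∂μ := by
  have h := ENNReal.lintegral_mul_le_Lp_mul_Lq μ Real.HolderConjugate.two_two hf hg
  have h2 := ENNReal.rpow_le_rpow h (by norm_num : (0 : ℝ) ≤ 2)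
  rw [ENNReal.mul_rpow_of_nonneg _ _ (by norm_num), ← ENNReal.rpow_mul, ← ENNReal.rpow_mul] at h2
  simpa using h2

section
variable {N : ℕ} {t w : Fin N → ℝ}

/-- The weighted `L²` error of the exponential sum with interpolatory quadrature weights. -/
theorem lintegral_integral_quadErr_le (hN : 0 < N) (ht : IsHermiteZeros N t)
    (hw : ∀ p : ℝ[X], p.degree < N → quadErr t w p 0 = 0) :
    ∫⁻ y : ℝ, ‖∫ η : ℝ, quadErr t w 1 (η - Complex.I * y) *
        Complex.exp (-4 * (η + Complex.I * y / 2) ^ 2)‖ₑ ^ 2 * ENNReal.ofReal (Real.exp (-6 * y ^ 2))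
      ≤ ENNReal.ofReal (Real.sqrt (Real.pi / 2) * Real.pi / 2 * N / 16 ^ N) := by
  set c : ℝ := 2 ^ N * N.factorial / (2 * N).factorial with hc
  have hc0 : 0 ≤ c := by positivity
  have hpt : ∀ y : ℝ, ‖∫ η : ℝ, quadErr t w 1 (η - Complex.I * y) *
        Complex.exp (-4 * (η + Complex.I * y / 2) ^ 2)‖ₑ ^ 2 * ENNReal.ofReal (Real.exp (-6 * y ^ 2))
      ≤ ENNReal.ofReal (c ^ 2 * Real.sqrt (Real.pi / 2)) * ∫⁻ x : ℝ,
        ENNReal.ofReal ((x ^ 2 + y ^ 2) ^ (2 * N) * Real.exp (-4 * (x ^ 2 + y ^ 2))) := by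
    intro y
    have h1 : ‖∫ η : ℝ, quadErr t w 1 (η - Complex.I * y) *
        Complex.exp (-4 * (η + Complex.I * y / 2) ^ 2)‖ₑ ≤
        ∫⁻ η : ℝ, ENNReal.ofReal (c * Real.exp (y ^ 2) *
          ((η ^ 2 + y ^ 2) ^ N * Real.exp (-2 * η ^ 2))) *
          ENNReal.ofReal (Real.exp (-η ^ 2)) := by
      refine (enorm_integral_le_lintegral_enorm _).trans (lintegral_mono_ae ?_)
      -- The pointwise bound is only available off the line `Re z = 0`.
      filter_upwards [compl_mem_ae_iff.2 (measure_singleton (0 : ℝ))] with η hη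
      have hre : ((η : ℂ) - Complex.I * y).re = η := by simp
      have hnorm : ‖(η : ℂ) - Complex.I * y‖ ^ 2 = η ^ 2 + y ^ 2 := by
        rw [Complex.sq_norm, Complex.normSq_apply]; simp [pow_two]
      have hb := norm_quadErr_one_le_of_re_ne_zero hN ht hw (z := (η : ℂ) - Complex.I * y)
        (by rw [hre]; exact hη)
      rw [hre, pow_mul, hnorm] at hb
      rw [← ENNReal.ofReal_mul (by positivity), ← ofReal_norm]
      refine ENNReal.ofReal_le_ofReal ?_
      rw [norm_mul, Complex.norm_exp]
      have he : (-4 * ((η : ℂ) + Complex.I * y / 2) ^ 2).re = -4 * η ^ 2 + y ^ 2 := by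
        have : (-4 * ((η : ℂ) + Complex.I * y / 2) ^ 2) =
            ((-4 * η ^ 2 + y ^ 2 : ℝ) : ℂ) + ((-4 * η * y : ℝ) : ℂ) * Complex.I := by
          push_cast
          linear_combination -(y : ℂ) ^ 2 * Complex.I_sq
        rw [this]; simp [pow_two]
      rw [he]
      calc _ ≤ (c * (η ^ 2 + y ^ 2) ^ N * Real.exp (η ^ 2)) * Real.exp (-4 * η ^ 2 + y ^ 2) := by
            gcongr
        _ = c * (η ^ 2 + y ^ 2) ^ N * Real.exp (η ^ 2 + (-4 * η ^ 2 + y ^ 2)) := by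
            rw [mul_assoc, ← Real.exp_add]
        _ = c * (η ^ 2 + y ^ 2) ^ N * Real.exp (y ^ 2 + -2 * η ^ 2 + -η ^ 2) := by
            congr 2; ring
        _ = _ := by rw [Real.exp_add, Real.exp_add]; ring
    have h2 : ∫⁻ η : ℝ, ENNReal.ofReal (Real.exp (-η ^ 2)) ^ 2 =
        ENNReal.ofReal (Real.sqrt (Real.pi / 2)) := by
      rw [← integral_gaussian, ofReal_integral_eq_lintegral_ofReal
        (integrable_exp_neg_mul_sq (by norm_num)) (Filter.Eventually.of_forall fun _ => by positivity)]
      refine lintegral_congr fun η => ?_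
      rw [← ENNReal.ofReal_pow (by positivity), ← Real.exp_nat_mul]
      congr 2
      push_cast; ring
    calc _ ≤ ((∫⁻ η : ℝ, ENNReal.ofReal (c * Real.exp (y ^ 2) *
          ((η ^ 2 + y ^ 2) ^ N * Real.exp (-2 * η ^ 2))) ^ 2) *
          ∫⁻ η : ℝ, ENNReal.ofReal (Real.exp (-η ^ 2)) ^ 2) *
          ENNReal.ofReal (Real.exp (-6 * y ^ 2)) := by
          gcongr
          exact (pow_le_pow_left' h1 2).trans (sq_lintegral_mul_le (by fun_prop) (by fun_prop))
      _ = _ := by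
          rw [h2, mul_right_comm, mul_comm, ← lintegral_mul_const' _ _ (by simp),
            ← lintegral_const_mul' _ _ (by simp), ← lintegral_const_mul' _ _ (by simp)]
          refine lintegral_congr fun η => ?_
          rw [← ENNReal.ofReal_pow (by positivity), ← ENNReal.ofReal_mul (by positivity),
            ← ENNReal.ofReal_mul (by positivity), ← ENNReal.ofReal_mul (by positivity)]
          congr 1
          have h3 : Real.exp (-4 * (η ^ 2 + y ^ 2)) = Real.exp (y ^ 2) ^ 2 *
              Real.exp (-2 * η ^ 2) ^ 2 * Real.exp (-6 * y ^ 2) := by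
            rw [← Real.exp_nat_mul, ← Real.exp_nat_mul, ← Real.exp_add, ← Real.exp_add]
            congr 1; push_cast; ring
          rw [h3]
          ring
  refine (lintegral_mono hpt).trans ?_
  rw [lintegral_const_mul' _ _ (by simp), lintegral_lintegral_normSq_pow_mul_exp,
    ← ENNReal.ofReal_mul (by positivity)]
  refine ENNReal.ofReal_le_ofReal ?_
  -- `c² (2N)! = 4^N / centralBinom N`
  have hcb : c ^ 2 * (2 * N).factorial ≤ 2 * N := by
    have h1 : (4 : ℝ) ^ N ≤ 2 * N * N.centralBinom := by
      exact_mod_cast Nat.four_pow_le_two_mul_self_mul_centralBinom N hN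
    have h2 : (N.centralBinom : ℝ) * (N.factorial * N.factorial) = (2 * N).factorial := by
      have := Nat.choose_mul_factorial_mul_factorial (n := 2 * N) (k := N) (by omega)
      rw [show 2 * N - N = N by omega, mul_assoc] at this
      exact_mod_cast this
    have h3 : c ^ 2 * (2 * N).factorial =
        4 ^ N * (N.factorial * N.factorial) / (2 * N).factorial := by
      have : ((2 * N).factorial : ℝ) ≠ 0 := by positivity
      have h4 : (4 : ℝ) ^ N = 2 ^ N * 2 ^ N := by rw [← mul_pow]; norm_num
      rw [hc, h4]
      field_simp
    rw [h3, div_le_iff₀ (by positivity), ← h2]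
    calc (4 : ℝ) ^ N * (N.factorial * N.factorial)
        ≤ 2 * N * N.centralBinom * (N.factorial * N.factorial) := by gcongr
      _ = _ := by ring
  have h16 : (4 : ℝ) ^ (2 * N + 1) = 16 ^ N * 4 := by
    rw [pow_succ, pow_mul]; norm_num
  rw [h16]
  calc c ^ 2 * √(Real.pi / 2) * (Real.pi * (2 * N).factorial / (16 ^ N * 4))
      = √(Real.pi / 2) * Real.pi / 4 * (c ^ 2 * (2 * N).factorial) / 16 ^ N := by
        field_simp
    _ ≤ √(Real.pi / 2) * Real.pi / 4 * (2 * N) / 16 ^ N := by gcongr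
    _ = _ := by ring

end

/-! ### Best approximation in the weighted space -/

section
variable {N : ℕ} {σ : ℝ} {lam : Fin N → ℂ}

theorem continuous_expSum (lam gam : Fin N → ℂ) : Continuous (expSum lam gam) := by
  unfold expSum
  fun_prop

theorem norm_cexp_mul_ofReal_of_conj_eq_neg {l : ℂ} (hl : (starRingEnd ℂ) l = -l) (x : ℝ) :
    ‖Complex.exp (l * x)‖ = 1 := by
  have h : l.re = 0 := by
    have := congrArg Complex.re hl
    simp only [Complex.conj_re, Complex.neg_re] at this
    linarith
  rw [Complex.norm_exp]
  simp [h]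

theorem norm_expSum_le (hlam : ∀ j, (starRingEnd ℂ) (lam j) = -lam j) (gam : Fin N → ℂ) (x : ℝ) :
    ‖expSum lam gam x‖ ≤ ∑ j, ‖gam j‖ := by
  refine (norm_sum_le _ _).trans (Finset.sum_le_sum fun j _ => ?_)
  rw [norm_mul, norm_cexp_mul_ofReal_of_conj_eq_neg (hlam j), mul_one]

theorem integrable_mul_exp_neg_sq_div (hσ : 0 < σ) {φ : ℝ → ℝ} (hφ : Continuous φ) {B : ℝ}
    (hB : ∀ x, |φ x| ≤ B) : Integrable fun x => φ x * Real.exp (-x ^ 2 / σ) := by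
  have h : Integrable fun x : ℝ => Real.exp (-x ^ 2 / σ) := by
    convert integrable_exp_neg_mul_sq (inv_pos.2 hσ) using 3
    ring
  exact h.bdd_mul hφ.aestronglyMeasurable (Filter.Eventually.of_forall hB)

/-- The linear system says that the error of the exponential sum is orthogonal, in `L²` with weight
`e^{-x²/σ}`, to all exponentials involved. -/
theorem integral_error_mul_cexp_eq_zero (hσ : 0 < σ) {gam : Fin N → ℂ} {k : Fin N}
    (hsys : ∑ j, Complex.exp ((lam j - lam k) ^ 2 * σ / 4) * gam j =
      (Real.sqrt (2 / 3) : ℂ) * Complex.exp (σ * lam k ^ 2 / 6)) :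
    ∫ x : ℝ, (Real.exp (-x ^ 2 / (2 * σ)) - expSum lam gam x) * Complex.exp (-lam k * x) *
      Real.exp (-x ^ 2 / σ) = 0 := by
  have hσ' : (σ : ℂ) ≠ 0 := by exact_mod_cast hσ.ne'
  have h1 : 0 < 3 / (2 * σ) := by positivity
  have h2 : 0 < 1 / σ := by positivity
  have hsplit : ∀ x : ℝ, (Real.exp (-x ^ 2 / (2 * σ)) - expSum lam gam x) *
      Complex.exp (-lam k * x) * Real.exp (-x ^ 2 / σ) =
      Complex.exp (-(3 / (2 * σ) : ℝ) * x ^ 2 + (-lam k) * x + 0) -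
      ∑ j, gam j * Complex.exp (-(1 / σ : ℝ) * x ^ 2 + (lam j - lam k) * x + 0) := by
    intro x
    rw [sub_mul, sub_mul, expSum, Finset.sum_mul, Finset.sum_mul]
    push_cast
    congr 1
    · rw [← Complex.exp_add, ← Complex.exp_add]
      congr 1
      field_simp
      ring
    · refine Finset.sum_congr rfl fun j _ => ?_
      rw [mul_assoc, mul_assoc, ← Complex.exp_add, ← Complex.exp_add]
      congr 2
      field_simp
      ring
  simp_rw [hsplit]
  rw [integral_sub (integrable_cexp_neg_mul_sq_add h1 _ _)
    (integrable_finsetSum _ fun j _ => (integrable_cexp_neg_mul_sq_add h2 _ _).const_mul _),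
    integral_finsetSum _ fun j _ => (integrable_cexp_neg_mul_sq_add h2 _ _).const_mul _]
  simp_rw [integral_const_mul, integral_cexp_neg_mul_sq_add h1, integral_cexp_neg_mul_sq_add h2]
  have h3 : Real.sqrt (Real.pi / (3 / (2 * σ))) =
      Real.sqrt (Real.pi / (1 / σ)) * Real.sqrt (2 / 3) := by
    rw [← Real.sqrt_mul (by positivity)]
    congr 1
    field_simp
  have h4 : ∀ j, gam j * ((Real.sqrt (Real.pi / (1 / σ)) : ℂ) *
      Complex.exp (0 + (lam j - lam k) ^ 2 / (4 * (1 / σ : ℝ)))) =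
      (Real.sqrt (Real.pi / (1 / σ)) : ℂ) *
        (Complex.exp ((lam j - lam k) ^ 2 * σ / 4) * gam j) := by
    intro j
    have : 0 + (lam j - lam k) ^ 2 / (4 * ((1 / σ : ℝ) : ℂ)) = (lam j - lam k) ^ 2 * σ / 4 := by
      push_cast
      field_simp
      ring
    rw [this]; ring
  have h5 : 0 + (-lam k) ^ 2 / (4 * ((3 / (2 * σ) : ℝ) : ℂ)) = σ * lam k ^ 2 / 6 := by
    push_cast
    field_simp
    ring
  simp_rw [h4]
  rw [← Finset.mul_sum, hsys, h3, h5]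
  push_cast
  ring

/-- Best approximation: a solution of the linear system minimizes the weighted `L²` error among all
exponential sums with the given imaginary frequencies. -/
theorem lintegral_weighted_error_le (hσ : 0 < σ) (hlam : ∀ j, (starRingEnd ℂ) (lam j) = -lam j)
    {gam : Fin N → ℂ}
    (hsys : ∀ k, ∑ j, Complex.exp ((lam j - lam k) ^ 2 * σ / 4) * gam j =
      (Real.sqrt (2 / 3) : ℂ) * Complex.exp (σ * lam k ^ 2 / 6)) (del : Fin N → ℂ) :
    ∫⁻ x : ℝ, ‖(Real.exp (-x ^ 2 / (2 * σ)) : ℂ) - expSum lam gam x‖ₑ ^ 2 *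
        ENNReal.ofReal (Real.exp (-x ^ 2 / σ)) ≤
      ∫⁻ x : ℝ, ‖(Real.exp (-x ^ 2 / (2 * σ)) : ℂ) - expSum lam del x‖ₑ ^ 2 *
        ENNReal.ofReal (Real.exp (-x ^ 2 / σ)) := by
  have hcont : ∀ c : Fin N → ℂ, Continuous fun x : ℝ =>
      (Real.exp (-x ^ 2 / (2 * σ)) : ℂ) - expSum lam c x := fun c => by
    have := continuous_expSum lam c
    fun_prop
  have hbdd : ∀ (c : Fin N → ℂ) (x : ℝ),
      ‖(Real.exp (-x ^ 2 / (2 * σ)) : ℂ) - expSum lam c x‖ ≤ 1 + ∑ j, ‖c j‖ := fun c x => by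
    refine (norm_sub_le _ _).trans (add_le_add ?_ (norm_expSum_le hlam c x))
    rw [Complex.norm_real, Real.norm_of_nonneg (Real.exp_pos _).le, Real.exp_le_one_iff,
      neg_div, neg_nonpos]
    positivity
  have hint : ∀ c : Fin N → ℂ, Integrable fun x : ℝ =>
      ‖(Real.exp (-x ^ 2 / (2 * σ)) : ℂ) - expSum lam c x‖ ^ 2 * Real.exp (-x ^ 2 / σ) := fun c =>
    integrable_mul_exp_neg_sq_div hσ ((hcont c).norm.pow 2) (B := (1 + ∑ j, ‖c j‖) ^ 2) fun x => by
      rw [abs_of_nonneg (by positivity)]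
      gcongr
      exact hbdd c x
  have hlint : ∀ c : Fin N → ℂ, ∫⁻ x : ℝ, ‖(Real.exp (-x ^ 2 / (2 * σ)) : ℂ) - expSum lam c x‖ₑ ^ 2 *
        ENNReal.ofReal (Real.exp (-x ^ 2 / σ)) = ENNReal.ofReal (∫ x : ℝ,
        ‖(Real.exp (-x ^ 2 / (2 * σ)) : ℂ) - expSum lam c x‖ ^ 2 * Real.exp (-x ^ 2 / σ)) := fun c => by
    rw [ofReal_integral_eq_lintegral_ofReal (hint c)
      (Filter.Eventually.of_forall fun x => by positivity)]
    refine lintegral_congr fun x => ?_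
    rw [ENNReal.ofReal_mul (by positivity), ENNReal.ofReal_pow (norm_nonneg _), ofReal_norm]
  rw [hlint, hlint]
  refine ENNReal.ofReal_le_ofReal ?_
  set g : ℝ → ℂ := fun x => (Real.exp (-x ^ 2 / (2 * σ)) : ℂ) - expSum lam gam x with hg
  set h : ℝ → ℂ := fun x => expSum lam (fun j => gam j - del j) x with hh
  have hgh : ∀ x, (Real.exp (-x ^ 2 / (2 * σ)) : ℂ) - expSum lam del x = g x + h x := fun x => by
    simp only [hg, hh, expSum, sub_mul, Finset.sum_sub_distrib]
    ring
  have hhc : ∀ x, (starRingEnd ℂ) (h x) =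
      ∑ k, (starRingEnd ℂ) (gam k - del k) * Complex.exp (-lam k * x) := fun x => by
    simp only [hh, expSum, map_sum, map_mul, ← Complex.exp_conj, hlam, Complex.conj_ofReal]
  have hi : ∀ k, Integrable fun x : ℝ => g x * Complex.exp (-lam k * x) * Real.exp (-x ^ 2 / σ) := by
    intro k
    have h1 : Integrable fun x : ℝ => ((Real.exp (-x ^ 2 / σ) : ℝ) : ℂ) := by
      simpa using (integrable_mul_exp_neg_sq_div hσ (φ := fun _ => 1) continuous_const
        (B := 1) (by simp)).ofReal (𝕜 := ℂ)
    refine h1.bdd_mul (c := 1 + ∑ j, ‖gam j‖) ?_ (Filter.Eventually.of_forall fun x => ?_)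
    · exact ((hcont gam).mul (by fun_prop)).aestronglyMeasurable
    · rw [norm_mul, norm_cexp_mul_ofReal_of_conj_eq_neg (by simp [hlam]), mul_one]
      exact hbdd gam x
  have hexp : ∀ x : ℝ, g x * (starRingEnd ℂ) (h x) * Real.exp (-x ^ 2 / σ) =
      ∑ k, (starRingEnd ℂ) (gam k - del k) *
        (g x * Complex.exp (-lam k * x) * Real.exp (-x ^ 2 / σ)) := fun x => by
    rw [hhc, Finset.mul_sum, Finset.sum_mul]
    exact Finset.sum_congr rfl fun k _ => by ring
  have hicross : Integrable fun x : ℝ =>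
      g x * (starRingEnd ℂ) (h x) * Real.exp (-x ^ 2 / σ) := by
    simp_rw [hexp]
    exact integrable_finsetSum _ fun k _ => (hi k).const_mul _
  have hcross : ∫ x : ℝ, g x * (starRingEnd ℂ) (h x) * Real.exp (-x ^ 2 / σ) = 0 := by
    simp_rw [hexp]
    rw [integral_finsetSum _ fun k _ => (hi k).const_mul _]
    refine Finset.sum_eq_zero fun k _ => ?_
    rw [integral_const_mul, integral_error_mul_cexp_eq_zero hσ (hsys k), mul_zero]
  have hcross' : ∫ x : ℝ, (g x * (starRingEnd ℂ) (h x) * Real.exp (-x ^ 2 / σ)).re = 0 := by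
    have := integral_re hicross
    simp only [RCLike.re_to_complex] at this
    rw [this, hcross, Complex.zero_re]
  have hire : Integrable fun x : ℝ =>
      2 * (g x * (starRingEnd ℂ) (h x) * Real.exp (-x ^ 2 / σ)).re := hicross.re.const_mul 2
  have hle : ∫ x : ℝ, ‖g x‖ ^ 2 * Real.exp (-x ^ 2 / σ) ≤
      ∫ x : ℝ, (‖(Real.exp (-x ^ 2 / (2 * σ)) : ℂ) - expSum lam del x‖ ^ 2 * Real.exp (-x ^ 2 / σ)
        - 2 * (g x * (starRingEnd ℂ) (h x) * Real.exp (-x ^ 2 / σ)).re) := by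
    refine integral_mono (hint gam) ((hint del).sub hire) fun x => ?_
    simp only
    rw [hgh, Complex.re_mul_ofReal, Complex.sq_norm, Complex.sq_norm, Complex.normSq_add]
    have h1 := Complex.normSq_nonneg (h x)
    have h2 := Real.exp_pos (-x ^ 2 / σ)
    nlinarith
  rwa [integral_sub (hint del) hire, integral_const_mul, hcross', mul_zero, sub_zero] at hle

/-- There are coefficients with small weighted error: up to constants, those of Gauss–Hermite
quadrature multiplied by `e^{t_j²/4}`. -/
theorem exists_lintegral_weighted_error_le (hσ : 0 < σ) (hN : 0 < N) {t : Fin N → ℝ}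
    (ht : IsHermiteZeros N t)
    (hlam : ∀ j, lam j = -Complex.I * (Real.sqrt (3 / (2 * σ)) : ℂ) * (t j : ℂ)) :
    ∃ del : Fin N → ℂ,
      ∫⁻ x : ℝ, ‖(Real.exp (-x ^ 2 / (2 * σ)) : ℂ) - expSum lam del x‖ₑ ^ 2 *
        ENNReal.ofReal (Real.exp (-x ^ 2 / σ)) ≤
      ENNReal.ofReal (3 / Real.sqrt (3 / (2 * σ)) * (3 / Real.pi *
        (Real.sqrt (Real.pi / 2) * Real.pi / 2 * N / 16 ^ N))) := by
  obtain ⟨w, hw⟩ := exists_weights_quadErr_zero ht.1.injective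
  set a := Real.sqrt (3 / (2 * σ)) with ha
  have ha0 : 0 < a := by positivity
  have ha2 : a ^ 2 = 3 / (2 * σ) := Real.sq_sqrt (by positivity)
  set J : ℝ → ℂ := fun y => ∫ η : ℝ, quadErr t w 1 (η - Complex.I * y) *
        Complex.exp (-4 * (η + Complex.I * y / 2) ^ 2) with hJ
  set s : ℂ := (Real.sqrt (3 / Real.pi) : ℂ) with hs
  refine ⟨fun j => s * (w j * ((Real.sqrt (Real.pi / 4) : ℂ) * Complex.exp ((t j : ℂ) ^ 2 / 4))), ?_⟩
  have hpt : ∀ x : ℝ, (Real.exp (-x ^ 2 / (2 * σ)) : ℂ) - expSum lam (fun j => s * (w j *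
      ((Real.sqrt (Real.pi / 4) : ℂ) * Complex.exp ((t j : ℂ) ^ 2 / 4)))) x = s * J (a / 3 * x) := by
    intro x
    simp only [hJ]
    rw [integral_quadErr_one_mul_cexp, mul_sub, ← mul_assoc]
    congr 1
    · have h1 : s * (Real.sqrt (Real.pi / 3) : ℂ) = 1 := by
        rw [hs, ← Complex.ofReal_mul, ← Real.sqrt_mul (by positivity)]
        have : 3 / Real.pi * (Real.pi / 3) = 1 := by field_simp
        rw [this]; simp
      have h2 : (-3 * ((a / 3 * x : ℝ) : ℂ) ^ 2) = ((-x ^ 2 / (2 * σ) : ℝ) : ℂ) := by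
        rw [← Complex.ofReal_pow, mul_pow, div_pow, ha2]
        push_cast
        field_simp
      rw [h1, h2, one_mul, Complex.ofReal_exp]
    · rw [expSum, Finset.mul_sum]
      refine Finset.sum_congr rfl fun j _ => ?_
      have h3 : Complex.exp ((t j : ℂ) ^ 2 / 4 - 3 * Complex.I * t j * ((a / 3 * x : ℝ) : ℂ)) =
          Complex.exp ((t j : ℂ) ^ 2 / 4) * Complex.exp (lam j * x) := by
        rw [← Complex.exp_add, hlam]
        congr 1
        push_cast
        ring
      rw [h3]
      ring
  have hscale : ∀ Φ : ℝ → ENNReal, ∫⁻ x : ℝ, Φ (a / 3 * x) = ENNReal.ofReal (3 / a) * ∫⁻ y, Φ y := by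
    intro Φ
    have h0 : a / 3 ≠ 0 := by positivity
    have h1 := (Homeomorph.mulLeft₀ (a / 3) h0).measurableEmbedding.lintegral_map (μ := volume) Φ
    simp only [Homeomorph.coe_mulLeft₀] at h1
    rw [← h1, Real.map_volume_mul_left h0, lintegral_smul_measure, smul_eq_mul, inv_div,
      abs_of_pos (by positivity)]
  calc _ = ∫⁻ x : ℝ, ENNReal.ofReal (3 / Real.pi) * (‖J (a / 3 * x)‖ₑ ^ 2 *
        ENNReal.ofReal (Real.exp (-6 * (a / 3 * x) ^ 2))) := by
        refine lintegral_congr fun x => ?_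
        have h1 : ‖s‖ₑ ^ 2 = ENNReal.ofReal (3 / Real.pi) := by
          rw [← ofReal_norm, hs, Complex.norm_real, Real.norm_of_nonneg (Real.sqrt_nonneg _),
            ← ENNReal.ofReal_pow (Real.sqrt_nonneg _), Real.sq_sqrt (by positivity)]
        have h2 : -6 * (a / 3 * x) ^ 2 = -x ^ 2 / σ := by
          rw [mul_pow, div_pow, ha2]
          field_simp
          ring
        rw [hpt, enorm_mul, mul_pow, h1, h2, mul_assoc]
    _ = ENNReal.ofReal (3 / a) * (ENNReal.ofReal (3 / Real.pi) * ∫⁻ y : ℝ, ‖J y‖ₑ ^ 2 *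
        ENNReal.ofReal (Real.exp (-6 * y ^ 2))) := by
        rw [hscale fun y => ENNReal.ofReal (3 / Real.pi) * (‖J y‖ₑ ^ 2 *
          ENNReal.ofReal (Real.exp (-6 * y ^ 2))), lintegral_const_mul' _ _ (by simp)]
    _ ≤ ENNReal.ofReal (3 / a) * (ENNReal.ofReal (3 / Real.pi) *
        ENNReal.ofReal (Real.sqrt (Real.pi / 2) * Real.pi / 2 * N / 16 ^ N)) := by
        gcongr
        exact lintegral_integral_quadErr_le hN ht hw
    _ = _ := by
        rw [← ENNReal.ofReal_mul (by positivity), ← ENNReal.ofReal_mul (by positivity)]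

end

/-! ### Truncation and the final estimate -/

theorem exp_neg_sq_div_le_of_le_abs {σ T x : ℝ} (hσ : 0 < σ) (hT : 0 ≤ T) (hx : T ≤ |x|) :
    Real.exp (-x ^ 2 / σ) ≤ Real.exp (-T ^ 2 / σ) *
      (Real.exp (-(x - T) ^ 2 / σ) + Real.exp (-(x - -T) ^ 2 / σ)) := by
  have key : ∀ u, T * u + T * u ≥ 2 * T ^ 2 → Real.exp (-u ^ 2 / σ) ≤
      Real.exp (-T ^ 2 / σ) * Real.exp (-(u - T) ^ 2 / σ) := by
    intro u hu
    rw [← Real.exp_add, ← add_div]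
    gcongr
    nlinarith
  rcases le_total 0 x with h | h
  · rw [abs_of_nonneg h] at hx
    refine (key x (by nlinarith)).trans ?_
    gcongr
    exact le_add_of_nonneg_right (Real.exp_pos _).le
  · rw [abs_of_nonpos h] at hx
    have := key (-x) (by nlinarith)
    rw [neg_sq, show (-x - T) ^ 2 = (x - -T) ^ 2 by ring] at this
    refine this.trans ?_
    gcongr
    exact le_add_of_nonneg_left (Real.exp_pos _).le

theorem lintegral_exp_neg_sub_sq_div {σ : ℝ} (hσ : 0 < σ) (T : ℝ) :
    ∫⁻ x : ℝ, ENNReal.ofReal (Real.exp (-(x - T) ^ 2 / σ)) =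
      ENNReal.ofReal (Real.sqrt (Real.pi * σ)) := by
  rw [lintegral_sub_right_eq_self (fun x : ℝ => ENNReal.ofReal (Real.exp (-x ^ 2 / σ))) T]
  have h := integral_gaussian σ⁻¹
  have h2 := integrable_exp_neg_mul_sq (inv_pos.2 hσ)
  have h3 : ∀ x : ℝ, -σ⁻¹ * x ^ 2 = -x ^ 2 / σ := fun x => by ring
  simp_rw [h3] at h h2
  rw [← ofReal_integral_eq_lintegral_ofReal h2 (Filter.Eventually.of_forall fun _ => by positivity),
    h, div_inv_eq_mul]

/-- The weight `e^{-x²/σ}` is at least `e^{-T²/σ}` on `[-T, T]`; it is also the square of the target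
function, which is all that is left outside. -/
theorem eLpNorm_error_sq_le {σ T : ℝ} (hσ : 0 < σ) (hT : 0 ≤ T) (S : ℝ → ℂ) :
    (eLpNorm (fun x : ℝ => (Real.exp (-x ^ 2 / (2 * σ)) : ℂ)
        - (Set.Icc (-T) T).indicator S x) 2 volume) ^ 2 ≤
      ENNReal.ofReal (Real.exp (T ^ 2 / σ)) *
        (∫⁻ x : ℝ, ‖(Real.exp (-x ^ 2 / (2 * σ)) : ℂ) - S x‖ₑ ^ 2 *
          ENNReal.ofReal (Real.exp (-x ^ 2 / σ))) +
      ENNReal.ofReal (Real.exp (-T ^ 2 / σ) * (2 * Real.sqrt (Real.pi * σ))) := by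
  have h := eLpNorm_nnreal_pow_eq_lintegral (μ := (volume : Measure ℝ)) (p := 2)
    (f := fun x : ℝ => (Real.exp (-x ^ 2 / (2 * σ)) : ℂ)
        - (Set.Icc (-T) T).indicator S x) (by norm_num)
  simp only [ENNReal.coe_ofNat, NNReal.coe_ofNat, ENNReal.rpow_ofNat] at h
  rw [h]
  have htail : ENNReal.ofReal (Real.exp (-T ^ 2 / σ) * (2 * Real.sqrt (Real.pi * σ))) =
      ∫⁻ x : ℝ, ENNReal.ofReal (Real.exp (-T ^ 2 / σ)) *
        (ENNReal.ofReal (Real.exp (-(x - T) ^ 2 / σ)) +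
          ENNReal.ofReal (Real.exp (-(x - -T) ^ 2 / σ))) := by
    rw [lintegral_const_mul' _ _ (by simp), lintegral_add_left (by fun_prop),
      lintegral_exp_neg_sub_sq_div hσ, lintegral_exp_neg_sub_sq_div hσ,
      ← ENNReal.ofReal_add (by positivity) (by positivity), ← ENNReal.ofReal_mul (by positivity)]
    congr 2
    ring
  rw [htail, ← lintegral_const_mul' _ _ (by simp), ← lintegral_add_right _ (by fun_prop)]
  refine lintegral_mono fun x => ?_
  by_cases hx : x ∈ Set.Icc (-T) T
  · rw [Set.indicator_of_mem hx]
    refine le_trans ?_ le_self_add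
    rw [mul_left_comm, ← ENNReal.ofReal_mul (by positivity), ← Real.exp_add]
    refine le_mul_of_one_le_right' ?_
    rw [ENNReal.one_le_ofReal, Real.one_le_exp_iff, ← add_div]
    have := sq_le_sq' hx.1 hx.2
    exact div_nonneg (by linarith) hσ.le
  · rw [Set.indicator_of_notMem hx, sub_zero]
    refine le_trans ?_ le_add_self
    have hx' : T ≤ |x| := by
      by_contra hlt
      exact hx (abs_le.1 (not_le.1 hlt).le)
    rw [← ofReal_norm, Complex.norm_real, Real.norm_of_nonneg (Real.exp_pos _).le,
      ← ENNReal.ofReal_pow (Real.exp_pos _).le, ← ENNReal.ofReal_add (by positivity) (by positivity),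
      ← ENNReal.ofReal_mul (by positivity), ← Real.exp_nat_mul]
    refine ENNReal.ofReal_le_ofReal (le_trans (le_of_eq ?_) (exp_neg_sq_div_le_of_le_abs hσ hT hx'))
    congr 1
    push_cast
    field_simp

theorem theorem3p4 (σ : ℝ) (hσ : 0 < σ) :
    ∃ c : ℝ, 0 < c ∧ ∀ N : ℕ, 1 < N → ∀ lam gam : Fin N → ℂ,
      IsPronyOutput σ (σ / 2) N lam gam →
      ∀ T : ℝ, T = Real.sqrt (2 * σ * (N : ℝ) * Real.log 2) →
        (eLpNorm (fun x : ℝ =>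
            (Real.exp (-x ^ 2 / (2 * σ)) : ℂ)
              - (Set.Icc (-T) T).indicator (expSum lam gam) x) 2 volume) ^ 2
          ≤ ENNReal.ofReal (c * (2 : ℝ) ^ (-2 * (N : ℝ)) * (N : ℝ) ^ (3 / 2 : ℝ)) := by
  set A : ℝ := 3 / Real.sqrt (3 / (2 * σ)) * (3 / Real.pi *
        (Real.sqrt (Real.pi / 2) * Real.pi / 2)) with hA
  have hA0 : 0 < A := by positivity
  refine ⟨A + 2 * Real.sqrt (Real.pi * σ), by positivity, ?_⟩
  rintro N hN lam gam ⟨⟨t, ht, hlam⟩, hsys⟩ T rfl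
  have hsqrt : Real.sqrt (2 * (σ / 2 + σ) / (σ * (2 * (σ / 2) + σ))) =
      Real.sqrt (3 / (2 * σ)) := by
    congr 1
    field_simp
    ring
  rw [hsqrt] at hlam
  have hconj : ∀ j, (starRingEnd ℂ) (lam j) = -lam j := fun j => by
    rw [hlam]
    simp
  have hσ' : (σ : ℂ) ≠ 0 := by exact_mod_cast hσ.ne'
  have hsys' : ∀ k, ∑ j, Complex.exp ((lam j - lam k) ^ 2 * σ / 4) * gam j =
      (Real.sqrt (2 / 3) : ℂ) * Complex.exp (σ * lam k ^ 2 / 6) := by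
    intro k
    have h1 : σ / (σ + σ / 2) = 2 / 3 := by field_simp; ring
    have h2 : (σ : ℂ) * ((σ / 2 : ℝ) : ℂ) * lam k ^ 2 / (2 * ((σ : ℂ) + ((σ / 2 : ℝ) : ℂ))) =
        σ * lam k ^ 2 / 6 := by
      push_cast
      field_simp
      ring
    have h3 : ∀ j, (lam j - lam k) ^ 2 * ((σ / 2 : ℝ) : ℂ) / 2 = (lam j - lam k) ^ 2 * σ / 4 := by
      intro j
      push_cast
      ring
    have := hsys k
    simp_rw [h3] at this
    rw [this, h1, h2]
  obtain ⟨del, hdel⟩ := exists_lintegral_weighted_error_le hσ (by omega : 0 < N) ht hlam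
  have hw := (lintegral_weighted_error_le hσ hconj hsys' del).trans hdel
  have hlog : 0 < Real.log 2 := Real.log_pos (by norm_num)
  have hT2 : Real.sqrt (2 * σ * (N : ℝ) * Real.log 2) ^ 2 = 2 * σ * N * Real.log 2 :=
    Real.sq_sqrt (by positivity)
  have h4 : Real.exp (2 * N * Real.log 2) = 4 ^ N := by
    rw [mul_comm, Real.exp_mul, Real.exp_log (by norm_num)]
    rw [show (2 * N : ℝ) = ((2 * N : ℕ) : ℝ) by push_cast; rfl, Real.rpow_natCast, pow_mul]
    norm_num
  have hexp : Real.exp (2 * σ * N * Real.log 2 / σ) = 4 ^ N := by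
    rw [← h4]; congr 1; field_simp
  have hexp' : Real.exp (-(2 * σ * N * Real.log 2) / σ) = (4 ^ N)⁻¹ := by
    rw [neg_div, Real.exp_neg, hexp]
  have h2N : (2 : ℝ) ^ (-2 * (N : ℝ)) = (4 ^ N)⁻¹ := by
    rw [← h4, ← Real.exp_neg, Real.rpow_def_of_pos (by norm_num)]
    congr 1; ring
  refine (eLpNorm_error_sq_le hσ (Real.sqrt_nonneg _) _).trans ?_
  rw [hT2, hexp, hexp', h2N]
  refine (add_le_add (mul_le_mul_right hw _) le_rfl).trans ?_
  rw [← ENNReal.ofReal_mul (by positivity), ← ENNReal.ofReal_add (by positivity) (by positivity)]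
  refine ENNReal.ofReal_le_ofReal ?_
  have hN1 : (1 : ℝ) ≤ N := by exact_mod_cast hN.le
  have hN2 : (N : ℝ) ≤ (N : ℝ) ^ (3 / 2 : ℝ) := by
    simpa using Real.rpow_le_rpow_of_exponent_le hN1 (by norm_num : (1 : ℝ) ≤ 3 / 2)
  have h16 : (16 : ℝ) ^ N = 4 ^ N * 4 ^ N := by rw [← mul_pow]; norm_num
  calc _ = (A * N + 2 * Real.sqrt (Real.pi * σ) * 1) * (4 ^ N)⁻¹ := by
        rw [hA, h16]
        field_simp
    _ ≤ (A * (N : ℝ) ^ (3 / 2 : ℝ) + 2 * Real.sqrt (Real.pi * σ) * (N : ℝ) ^ (3 / 2 : ℝ)) *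
        (4 ^ N)⁻¹ := by
        gcongr
        exact hN1.trans hN2
    _ = _ := by ring
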